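/- Let $(P,\preceq)$ be a finite poset with $n$ elements that is naturally labeled: its ground set is identified with $\{1,\dots,n\}$ in such a way that $a\prec b$ implies $a<b$. Let $\hat P=P\cup\{\hat 0\}$ be the poset obtained from $P$ by adjoining a minimum $\hat 0:=0$, and write $a\prec\!\!\cdot\, b$ for cover relations. For $a\preceq b$ in $\hat P$ let $d(a,b)$ be the minimal length of a saturated chain from $a$ to $b$. The Lipschitz polytope $\mathrm{Lip}(P)\subset\mathbb R^P$ is the set of all $f\colon P\to\mathbb R$ which, extended by $f(\hat 0)=0$, are nonnegative and isotone on $\hat P$ and satisfy $f(b)-f(a)\le d(a,b)$ for all $a\preceq b$ in $\hat P$. Its $h^*$-polynomial is $$h^*(\mathrm{Lip}(P),z)=(1-z)^{n+1}\sum_{k\ge 0}\bigl|k\,\mathrm{Lip}(P)\cap\mathbb Z^P\bigr|\,z^k .$$ For a permutation $\tau\in\mathfrak S_n$ put $\tau(0):=0$ and $\hat\tau:=\tau^{-1}$. Call $\tau$ descent-compatible with $P$ if for every $a\in P$ and every saturated chain $\hat 0=c_1\prec\!\!\cdot\, c_2\prec\!\!\cdot\cdots\prec\!\!\cdot\, c_k=a$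 in $\hat P$ the number of descents of the word $\tau(c_1)\tau(c_2)\cdots\tau(c_k)$ depends only on $a$, not on the chain. Let $\mathrm{DC}(P)$ be the set of descent-compatible permutations. For $\tau\in\mathrm{DC}(P)$ denote this number by $\mathrm{des}_{P,\tau}(a)$, with $\mathrm{des}_{P,\tau}(\hat 0)=0$, and let $\mathrm{stat}_P(\tau)$ be the number of $i\in\{0,\dots,n-1\}$ such that $$\mathrm{des}_{P,\tau}(\hat\tau(i))<\mathrm{des}_{P,\tau}(\hat\tau(i+1)),\quad\text{or}\quad \mathrm{des}_{P,\tau}(\hat\tau(i))=\mathrm{des}_{P,\tau}(\hat\tau(i+1))\ \text{ and }\ \hat\tau(i)>\hat\tau(i+1).$$ Then $$h^*\bigl(\mathrm{Lip}(P),z\bigr)=\sum_{\tau\in\mathrm{DC}(P)}z^{\mathrm{stat}_P(\tau)} .$$ -/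

import Mathlib

open scoped Pointwise

noncomputable section

namespace LipschitzPoset

/-! ### Saturated chains, Lipschitz functions and the Lipschitz polytope

For a poset `P`, the poset obtained by adjoining a minimum is `WithBot P`. -/

/-- `l` is a saturated chain `a = c₁ ⋖ c₂ ⋖ ⋯ ⋖ c_k = b`, written as the list of its elements. -/
def IsSaturatedChain {α : Type*} [PartialOrder α] (a b : α) (l : List α) : Prop :=
  l.IsChain (· ⋖ ·) ∧ l.head? = some a ∧ l.getLast? = some b

/-- The quasi-metric `d(a, b)`: the minimal length of a saturated chain from `a` to `b` (a chain
with `k` elements has length `k - 1`), and `⊤` if there is none. -/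
def chainDist {α : Type*} [PartialOrder α] (a b : α) : ℕ∞ :=
  ⨅ (l : List α) (_ : IsSaturatedChain a b l), ((l.length - 1 : ℕ) : ℕ∞)

/-- The order cone: nonnegative isotone functions. -/
def orderCone (α : Type*) [PartialOrder α] : Set (α → ℝ) :=
  {f | (∀ a, 0 ≤ f a) ∧ Monotone f}

/-- The (1-)Lipschitz condition `f b - f a ≤ d(a, b)` for all `a ≤ b`; in a finite poset
`d(a, b)` is finite for such pairs. -/
def IsLipschitz {α : Type*} [PartialOrder α] (f : α → ℝ) : Prop :=
  ∀ a b, a ≤ b → f b - f a ≤ ((chainDist a b).toNat : ℝ)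

/-- The extension of `f : P → ℝ` to `WithBot P` with value `0` at the adjoined minimum. -/
def extendBot {P : Type*} (f : P → ℝ) : WithBot P → ℝ :=
  WithBot.recBotCoe 0 f

/-- The Lipschitz polytope of `P`: Lipschitz functions in the order cone of `WithBot P` that
vanish at the adjoined minimum, as a subset of `ℝ^P`. -/
def lipschitzPolytope (P : Type*) [PartialOrder P] : Set (P → ℝ) :=
  {f | extendBot f ∈ orderCone (WithBot P) ∧ IsLipschitz (extendBot f)}

/-! ### Ehrhart function and `h*` -/

/-- The Ehrhart function `k ↦ |k Q ∩ ℤ^ι|`. -/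
def ehrhart {ι : Type*} (Q : Set (ι → ℝ)) (k : ℕ) : ℕ :=
  Set.ncard {x : ι → ℤ | (fun i => (x i : ℝ)) ∈ (k : ℝ) • Q}

/-- `(1 - z)^(n+1) ∑_{k ≥ 0} E(Q, k) z^k`, for a full-dimensional lattice polytope `Q` in `ℝ^ι`
with `n = |ι|`. -/
def hStar {ι : Type*} (Q : Set (ι → ℝ)) : PowerSeries ℤ :=
  (1 - PowerSeries.X) ^ (Nat.card ι + 1) * PowerSeries.mk (fun k => (ehrhart Q k : ℤ))

/-! ### Descent-compatible permutations and the statistic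

The poset `P` is labeled by `ω : P ≃ Fin n`; the label of `a` in `{1, …, n}` is `ω a + 1`, and the
adjoined minimum has label `0`. A permutation `τ` of `{1, …, n}` is a permutation of `Fin n` with
the same shift. -/

/-- The number of descents of a word. -/
def desWord (w : List ℕ) : ℕ :=
  (w.zip w.tail).countP (fun p => decide (p.2 < p.1))

/-- The extension of a permutation of `{1, …, n}` to `{0, …, n}` by `τ(0) = 0`. -/
def extendPerm {n : ℕ} (τ : Equiv.Perm (Fin n)) : Fin (n + 1) → Fin (n + 1) :=
  Fin.cons 0 (fun i => (τ i).succ)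

/-- The label in `{0, …, n}` of an element of `WithBot P`. -/
def label {P : Type*} {n : ℕ} (ω : P ≃ Fin n) : WithBot P → Fin (n + 1) :=
  WithBot.recBotCoe 0 (fun a => (ω a).succ)

/-- The element of `WithBot P` with a given label in `{0, …, n}`. -/
def element {P : Type*} {n : ℕ} (ω : P ≃ Fin n) : Fin (n + 1) → WithBot P :=
  Fin.cons ⊥ (fun i => ((ω.symm i : P) : WithBot P))

/-- The subword `τ(c₁) τ(c₂) ⋯ τ(c_k)` of `τ` for a list `c₁, …, c_k` of elements. -/
def subword {P : Type*} {n : ℕ} (ω : P ≃ Fin n) (τ : Equiv.Perm (Fin n))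
    (l : List (WithBot P)) : List ℕ :=
  l.map (fun a => (extendPerm τ (label ω a) : ℕ))

/-- `τ` is descent-compatible: for each `a`, the number of descents of `τ` along a saturated chain
from the adjoined minimum to `a` does not depend on the chain. -/
def IsDescentCompatible {P : Type*} [PartialOrder P] {n : ℕ} (ω : P ≃ Fin n)
    (τ : Equiv.Perm (Fin n)) : Prop :=
  ∀ (a : P) (l l' : List (WithBot P)),
    IsSaturatedChain (⊥ : WithBot P) (a : WithBot P) l →
    IsSaturatedChain (⊥ : WithBot P) (a : WithBot P) l' →
    desWord (subword ω τ l) = desWord (subword ω τ l')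

/-- `des_{P,τ}(a)`: the number of descents of `τ` along a saturated chain from the adjoined minimum
to `a`. The infimum selects the common value of all such chains when `τ` is descent-compatible;
see `desAt_eq` and `exists_isSaturatedChain`. -/
def desAt {P : Type*} [PartialOrder P] {n : ℕ} (ω : P ≃ Fin n) (τ : Equiv.Perm (Fin n))
    (a : WithBot P) : ℕ :=
  sInf {m | ∃ l, IsSaturatedChain (⊥ : WithBot P) a l ∧ desWord (subword ω τ l) = m}

/-- The inverse descent set `{0 ≤ i < n | τ⁻¹(i) > τ⁻¹(i+1)}`, with `τ⁻¹(0) = 0`. -/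
def iDes {n : ℕ} (τ : Equiv.Perm (Fin n)) : Set (Fin n) :=
  {i | extendPerm τ⁻¹ i.succ < extendPerm τ⁻¹ i.castSucc}

/-- The number of descents `des_{P,τ}(τ⁻¹(j))`, where `0 ≤ j ≤ n`. -/
def desInv {P : Type*} [PartialOrder P] {n : ℕ} (ω : P ≃ Fin n) (τ : Equiv.Perm (Fin n))
    (j : Fin (n + 1)) : ℕ :=
  desAt ω τ (element ω (extendPerm τ⁻¹ j))

/-- The statistic `stat_P(τ)`: the number of `0 ≤ i < n` such that
`des_{P,τ}(τ⁻¹(i)) < des_{P,τ}(τ⁻¹(i+1))`, or these are equal and `i` is an inverse descent. -/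
def stat {P : Type*} [PartialOrder P] {n : ℕ} (ω : P ≃ Fin n) (τ : Equiv.Perm (Fin n)) : ℕ :=
  Set.ncard {i : Fin n | desInv ω τ i.castSucc < desInv ω τ i.succ ∨
    (desInv ω τ i.castSucc = desInv ω τ i.succ ∧ i ∈ iDes τ)}

open Classical in
/-- The polynomial `∑ z^{stat_P(τ)}` over the descent-compatible permutations `τ`. -/
def statPolynomial {P : Type*} [PartialOrder P] {n : ℕ} (ω : P ≃ Fin n) : Polynomial ℤ :=
  ∑ τ : Equiv.Perm (Fin n) with IsDescentCompatible ω τ, Polynomial.X ^ stat ω τ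

/-! ### Consistency of the definitions -/

theorem isSaturatedChain_singleton {α : Type*} [PartialOrder α] (a : α) :
    IsSaturatedChain a a [a] := by
  simp [IsSaturatedChain]

theorem IsSaturatedChain.concat {α : Type*} [PartialOrder α] {a b c : α} {l : List α}
    (h : IsSaturatedChain a b l) (hbc : b ⋖ c) : IsSaturatedChain a c (l ++ [c]) := by
  obtain ⟨h1, h2, h3⟩ := h
  refine ⟨?_, ?_, by simp⟩
  · rw [List.isChain_append]
    refine ⟨h1, by simp, ?_⟩
    intro x hx y hy
    rw [h3] at hx
    simp at hx hy
    subst hx; subst hy; exact hbc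
  · simp [h2]

theorem exists_isSaturatedChain {α : Type*} [PartialOrder α] [Finite α] {a b : α} (h : a ≤ b) :
    ∃ l, IsSaturatedChain a b l := by
  induction b using WellFoundedLT.induction with
  | ind b ih =>
    rcases h.eq_or_lt with rfl | hlt
    · exact ⟨_, isSaturatedChain_singleton a⟩
    · obtain ⟨c, hac, hcb⟩ := exists_le_covBy_of_lt hlt
      obtain ⟨l, hl⟩ := ih c hcb.lt hac
      exact ⟨_, hl.concat hcb⟩

theorem desAt_eq {P : Type*} [PartialOrder P] {n : ℕ} {ω : P ≃ Fin n} {τ : Equiv.Perm (Fin n)}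
    (hτ : IsDescentCompatible ω τ) {a : P} {l : List (WithBot P)}
    (hl : IsSaturatedChain (⊥ : WithBot P) (a : WithBot P) l) :
    desAt ω τ a = desWord (subword ω τ l) := by
  have : {m | ∃ l, IsSaturatedChain (⊥ : WithBot P) (a : WithBot P) l ∧
      desWord (subword ω τ l) = m} = {desWord (subword ω τ l)} := by
    ext m
    constructor
    · rintro ⟨l', hl', rfl⟩
      exact hτ a l' l hl' hl
    · rintro rfl
      exact ⟨l, hl, rfl⟩
  rw [desAt, this, csInf_singleton]

theorem chainDist_le {α : Type*} [PartialOrder α] {a b : α} {l : List α}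
    (h : IsSaturatedChain a b l) : (chainDist a b).toNat ≤ l.length - 1 :=
  ENat.toNat_le_of_le_natCast (iInf₂_le l h)

theorem exists_chainDist_eq {α : Type*} [PartialOrder α] [Finite α] {a b : α} (h : a ≤ b) :
    ∃ l, IsSaturatedChain a b l ∧ chainDist a b = ((l.length - 1 : ℕ) : ℕ∞) := by
  obtain ⟨l₀, h₀⟩ := exists_isSaturatedChain h
  have : Nonempty {l // IsSaturatedChain a b l} := ⟨⟨l₀, h₀⟩⟩
  obtain ⟨⟨l, hl⟩, e⟩ := ciInf_mem
    (fun l : {l // IsSaturatedChain a b l} => ((l.1.length - 1 : ℕ) : ℕ∞))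
  refine ⟨l, hl, ?_⟩
  rw [chainDist, iInf_subtype', ← e]

theorem chain_bounds {α : Type*} [PartialOrder α] {g : α → ℝ}
    (hg : ∀ a b, a ⋖ b → 0 ≤ g b - g a ∧ g b - g a ≤ 1) (l : List α) :
    ∀ {a b : α}, IsSaturatedChain a b l →
      0 ≤ g b - g a ∧ g b - g a ≤ ((l.length - 1 : ℕ) : ℝ) := by
  induction l with
  | nil => intro a b h; simp [IsSaturatedChain] at h
  | cons x l ih =>
    intro a b h
    obtain ⟨h1, h2, h3⟩ := h
    simp at h2
    subst h2
    cases l with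
    | nil =>
      simp at h3
      subst h3
      simp
    | cons y l =>
      rw [List.isChain_cons_cons] at h1
      have hy := ih (a := y) (b := b) ⟨h1.2, by simp, by simpa using h3⟩
      have hxy := hg _ _ h1.1
      simp at hy ⊢
      constructor <;> linarith

/-- For a finite poset, the Lipschitz polytope is given by the inequalities `0 ≤ f a ≤ 1` for
minimal `a` and `0 ≤ f b - f a ≤ 1` for cover relations `a ⋖ b`. -/
theorem mem_lipschitzPolytope_iff {P : Type*} [PartialOrder P] [Finite P] (f : P → ℝ) :
    f ∈ lipschitzPolytope P ↔
      (∀ a, IsMin a → 0 ≤ f a ∧ f a ≤ 1) ∧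
      (∀ a b, a ⋖ b → 0 ≤ f b - f a ∧ f b - f a ≤ 1) := by
  have : Finite (WithBot P) := inferInstanceAs (Finite (Option P))
  have key : (∀ a b, a ⋖ b → 0 ≤ extendBot f b - extendBot f a ∧
      extendBot f b - extendBot f a ≤ 1) ↔
      (∀ a, IsMin a → 0 ≤ f a ∧ f a ≤ 1) ∧
      (∀ a b, a ⋖ b → 0 ≤ f b - f a ∧ f b - f a ≤ 1) := by
    constructor
    · intro h
      refine ⟨fun a ha => ?_, fun a b hab => ?_⟩
      · simpa [extendBot] using h ⊥ a (WithBot.bot_covBy_coe.2 ha)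
      · simpa [extendBot] using h a b (WithBot.coe_covBy_coe.2 hab)
    · rintro ⟨h1, h2⟩ a b hab
      induction b using WithBot.recBotCoe with
      | bot => exact absurd hab.lt not_lt_bot
      | coe b =>
        induction a using WithBot.recBotCoe with
        | bot => simpa [extendBot] using h1 b (WithBot.bot_covBy_coe.1 hab)
        | coe a => simpa [extendBot] using h2 a b (WithBot.coe_covBy_coe.1 hab)
  rw [← key]
  constructor
  · rintro ⟨⟨_, hm⟩, hL⟩ a b hab
    refine ⟨sub_nonneg.2 (hm hab.le), (hL a b hab.le).trans ?_⟩
    have := chainDist_le ((isSaturatedChain_singleton a).concat hab)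
    simp at this
    exact_mod_cast this
  · intro h
    have hm : Monotone (extendBot f) := by
      intro a b hab
      obtain ⟨l, hl⟩ := exists_isSaturatedChain hab
      exact sub_nonneg.1 (chain_bounds h l hl).1
    refine ⟨⟨fun a => ?_, hm⟩, fun a b hab => ?_⟩
    · have := hm (bot_le (a := a))
      simpa [extendBot] using this
    · obtain ⟨l, hl, e⟩ := exists_chainDist_eq hab
      rw [e]
      exact (chain_bounds h l hl).2

end LipschitzPoset

end

noncomputable section

namespace LipschitzPoset

/-! Lattice points of `k • Lip(P)` are the functions `g` on `P̂` with `g 0̂ = 0` that grow by an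
amount in `[0, k]` along each cover relation. Divide by `k`: `g = k * q + r` with `0 < r ≤ k`,
except that `g a = 0` gives `q a = r a = 0`. Sort `P̂` by increasing `r`, then decreasing `q`, then
increasing label; the resulting word is `τ⁻¹(0) ⋯ τ⁻¹(n)` for a unique `τ`. Along a cover relation
`q` grows by 0 or 1, and by 1 exactly at a descent of `τ` (`countsDescents_of_strictMono_sortKey`).
So `τ` is descent-compatible and `q` is `des_{P,τ}`.

Once `τ` is fixed, only `r` is free. Read along the word, it is a weakly increasing sequence from 0
bounded by `k`, strict wherever the tie-breaking rules would put the two neighbours in the other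
order. The number of these steps is `stat`. Conversely, every such sequence over a
descent-compatible `τ` gives a lattice point (`latticePoint_mem`), and distinct data give distinct
points (`latticePoint_injective`). With `m` strict steps these sequences have generating function
`z^m / (1 - z)^(n+1)`, and summing over `τ` gives the theorem. -/

/-! ### Counting staircases -/

/-- Sequences `0 = s₀ ≤ s₁ ≤ ⋯ ≤ s_n ≤ k` that increase strictly at the steps in `B`. -/
def staircases {n : ℕ} (B : Set (Fin n)) (k : ℕ) : Set (Fin (n + 1) → ℕ) :=
  {s | s 0 = 0 ∧ (∀ i : Fin n, s i.castSucc ≤ s i.succ ∧ (i ∈ B → s i.castSucc < s i.succ)) ∧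
    s (Fin.last n) ≤ k}

theorem monotone_of_mem_staircases {n : ℕ} {B : Set (Fin n)} {k : ℕ} {s : Fin (n + 1) → ℕ}
    (hs : s ∈ staircases B k) : Monotone s :=
  Fin.monotone_iff_le_succ.2 fun i => (hs.2.1 i).1

theorem le_of_mem_staircases {n : ℕ} {B : Set (Fin n)} {k : ℕ} {s : Fin (n + 1) → ℕ}
    (hs : s ∈ staircases B k) (j : Fin (n + 1)) : s j ≤ k :=
  (monotone_of_mem_staircases hs (Fin.le_last j)).trans hs.2.2

theorem finite_staircases {n : ℕ} (B : Set (Fin n)) (k : ℕ) : (staircases B k).Finite :=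
  (Set.finite_Iic (fun _ : Fin (n + 1) => k)).subset fun _ hs => le_of_mem_staircases hs

theorem partialSum_last {n : ℕ} (d : Fin n → ℕ) :
    Fin.partialSum d (Fin.last n) = ∑ i, d i := by
  rw [Fin.partialSum, Fin.val_last, List.take_of_length_le (by simp), List.sum_ofFn]

/-- The generating function of the nonnegative integers, or of the positive ones if `p` holds. -/
theorem one_sub_X_mul_mk_ite (p : Prop) [Decidable p] [∀ m, Decidable (p → 0 < m)] :
    (1 - PowerSeries.X) * PowerSeries.mk (fun m => if (p → 0 < m) then (1 : ℤ) else 0) =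
      PowerSeries.X ^ (if p then 1 else 0) := by
  ext m
  rw [sub_mul, one_mul, map_sub, PowerSeries.coeff_mk, mul_comm]
  rcases m with _ | m
  · by_cases p <;> simp [*]
  · rw [PowerSeries.coeff_succ_mul_X, PowerSeries.coeff_mk]
    by_cases p <;> rcases m with _ | m <;> simp [*, PowerSeries.coeff_X, PowerSeries.coeff_one]

-- The `n` increments of a staircase and the final slack `k - s n` form `n + 1` naturals of sum `k`;
-- partial sums invert this.
open Classical in
theorem ncard_staircases {n : ℕ} (B : Set (Fin n)) (k : ℕ) :
    (staircases B k).ncard = ((Finset.univ.finsuppAntidiag k).filter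
      fun l : Fin (n + 1) →₀ ℕ => ∀ i : Fin n, i ∈ B → 0 < l i.castSucc).card := by
  rw [← Set.ncard_coe_finset]
  symm
  refine Set.ncard_congr (fun l _ => Fin.partialSum fun i => l i.castSucc) ?_ ?_ ?_
  · intro l hl
    simp only [Finset.coe_filter, Set.mem_ofPred_eq, Finset.mem_finsuppAntidiag] at hl
    obtain ⟨⟨hsum, -⟩, hl⟩ := hl
    rw [Fin.sum_univ_castSucc] at hsum
    refine ⟨Fin.partialSum_zero _, fun i => ?_, ?_⟩
    · rw [Fin.partialSum_succ]
      exact ⟨by omega, fun hi => by have := hl i hi; omega⟩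
    · rw [partialSum_last]
      omega
  · intro l l' hl hl' h
    simp only [Finset.coe_filter, Set.mem_ofPred_eq, Finset.mem_finsuppAntidiag] at hl hl'
    have hi : ∀ i : Fin n, l i.castSucc = l' i.castSucc := fun i => by
      have h1 := congrFun h i.succ
      have h2 := congrFun h i.castSucc
      simp only [Fin.partialSum_succ] at h1 h2
      omega
    have h1 := hl.1.1
    have h2 := hl'.1.1
    rw [Fin.sum_univ_castSucc] at h1 h2
    simp only [hi] at h1
    ext j
    induction j using Fin.lastCases with
    | last => omega
    | cast i => exact hi i
  · intro s hs
    have hstep : ∀ j, Fin.partialSum (fun i : Fin n => s i.succ - s i.castSucc) j = s j := by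
      intro j
      induction j using Fin.induction with
      | zero => simp [hs.1]
      | succ i ih =>
        rw [Fin.partialSum_succ, ih]
        have := (hs.2.1 i).1
        omega
    refine ⟨Finsupp.equivFunOnFinite.symm
      (Fin.snoc (fun i : Fin n => s i.succ - s i.castSucc) (k - s (Fin.last n)) :
        Fin (n + 1) → ℕ), ?_, ?_⟩
    · simp only [Finset.coe_filter, Set.mem_ofPred_eq, Finset.mem_finsuppAntidiag]
      refine ⟨⟨?_, Finset.subset_univ _⟩, fun i hi => ?_⟩
      · rw [Fin.sum_univ_castSucc]
        have h1 := hstep (Fin.last n)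
        rw [partialSum_last] at h1
        have := hs.2.2
        simp only [Finsupp.equivFunOnFinite_symm_apply_apply, Fin.snoc_castSucc, Fin.snoc_last, h1]
        omega
      · have := (hs.2.1 i).2 hi
        simp
        omega
    · funext j
      simpa using hstep j

/-- The generating function of staircases is `z ^ |B| / (1 - z) ^ (n + 1)`. -/
theorem one_sub_X_pow_mul_mk_ncard_staircases {n : ℕ} (B : Set (Fin n)) :
    (1 - PowerSeries.X) ^ (n + 1) * PowerSeries.mk (fun k => ((staircases B k).ncard : ℤ)) =
      PowerSeries.X ^ B.ncard := by
  classical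
  -- One factor per increment, plus one for the slack at index `Fin.last n`, which is never forced
  -- to be positive.
  have hprod : PowerSeries.mk (fun k => ((staircases B k).ncard : ℤ)) =
      ∏ j : Fin (n + 1), PowerSeries.mk
        (fun m => if ((∃ i ∈ B, i.castSucc = j) → 0 < m) then (1 : ℤ) else 0) := by
    ext k
    rw [PowerSeries.coeff_mk, PowerSeries.coeff_prod, ncard_staircases, Finset.card_filter]
    push_cast
    refine Finset.sum_congr rfl fun l _ => ?_
    simp only [PowerSeries.coeff_mk, Finset.prod_ite_zero, Finset.prod_const_one]
    congr 1
    simp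
  have hpow : (1 - PowerSeries.X : PowerSeries ℤ) ^ (n + 1) =
      ∏ _j : Fin (n + 1), (1 - PowerSeries.X) := by simp
  rw [hprod, hpow, ← Finset.prod_mul_distrib]
  simp only [one_sub_X_mul_mk_ite]
  rw [Finset.prod_pow_eq_pow_sum, Fin.sum_univ_castSucc]
  congr 1
  have hlast : ¬ ∃ i ∈ B, i.castSucc = Fin.last n := by
    rintro ⟨i, -, hi⟩
    exact i.castSucc_ne_last hi
  rw [if_neg hlast, add_zero, Set.ncard_eq_toFinset_card', Finset.sum_boole]
  simp

/-! ### Lattice points of dilates -/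

/-- The functions `g : P̂ → ℕ` with `g 0̂ = 0` and `g a ≤ g b ≤ g a + k` along cover relations. -/
def coverBounded (P : Type*) [PartialOrder P] (k : ℕ) : Set (WithBot P → ℕ) :=
  {g | g ⊥ = 0 ∧ ∀ a b, a ⋖ b → g a ≤ g b ∧ g b ≤ g a + k}

theorem extendBot_smul {P : Type*} (c : ℝ) (f : P → ℝ) (a : WithBot P) :
    extendBot (c • f) a = c * extendBot f a := by
  induction a using WithBot.recBotCoe <;> simp [extendBot]

theorem mem_lipschitzPolytope_iff_extendBot {P : Type*} [PartialOrder P] [Finite P] (f : P → ℝ) :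
    f ∈ lipschitzPolytope P ↔
      ∀ a b, a ⋖ b → 0 ≤ extendBot f b - extendBot f a ∧ extendBot f b - extendBot f a ≤ 1 := by
  rw [mem_lipschitzPolytope_iff]
  constructor
  · rintro ⟨h1, h2⟩ a b hab
    induction b using WithBot.recBotCoe with
    | bot => exact absurd hab.lt not_lt_bot
    | coe b =>
      induction a using WithBot.recBotCoe with
      | bot => simpa [extendBot] using h1 b (WithBot.bot_covBy_coe.1 hab)
      | coe a => simpa [extendBot] using h2 a b (WithBot.coe_covBy_coe.1 hab)
  · intro h
    refine ⟨fun a ha => ?_, fun a b hab => ?_⟩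
    · simpa [extendBot] using h ⊥ a (WithBot.bot_covBy_coe.2 ha)
    · simpa [extendBot] using h a b (WithBot.coe_covBy_coe.2 hab)

theorem eq_zero_of_covBy_eq {P : Type*} [PartialOrder P] [Finite P] {f : P → ℝ}
    (h : ∀ a b, a ⋖ b → extendBot f b = extendBot f a) (a : WithBot P) : extendBot f a = 0 := by
  have : Finite (WithBot P) := inferInstanceAs (Finite (Option P))
  induction a using WellFoundedLT.induction with
  | ind a ih =>
    rcases (bot_le (a := a)).eq_or_lt with rfl | hlt
    · rfl
    · obtain ⟨c, -, hc⟩ := exists_le_covBy_of_lt hlt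
      rw [h c a hc, ih c hc.lt]

theorem mem_smul_lipschitzPolytope_iff {P : Type*} [PartialOrder P] [Finite P] (k : ℕ)
    (f : P → ℝ) : f ∈ (k : ℝ) • lipschitzPolytope P ↔
      ∀ a b, a ⋖ b → 0 ≤ extendBot f b - extendBot f a ∧ extendBot f b - extendBot f a ≤ k := by
  -- Scaling by 0 is not invertible. There both sides reduce to `f = 0`, since a function constant
  -- along covers takes its value at `⊥` everywhere.
  rcases Nat.eq_zero_or_pos k with rfl | hk
  · have h0 : (0 : P → ℝ) ∈ lipschitzPolytope P := by
      simp [mem_lipschitzPolytope_iff]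
    rw [Nat.cast_zero, Set.zero_smul_set ⟨0, h0⟩, Set.mem_zero]
    constructor
    · rintro rfl a b -
      have : ∀ c : WithBot P, extendBot (0 : P → ℝ) c = 0 := fun c => by
        induction c using WithBot.recBotCoe <;> rfl
      simp [this]
    · intro h
      funext a
      exact eq_zero_of_covBy_eq (fun a b hab => by have := h a b hab; linarith) (a : WithBot P)
  · have hk' : (0 : ℝ) < k := by exact_mod_cast hk
    rw [Set.mem_smul_set_iff_inv_smul_mem₀ hk'.ne', mem_lipschitzPolytope_iff_extendBot]
    refine forall₂_congr fun a b => imp_congr_right fun _ => ?_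
    simp only [extendBot_smul, ← mul_sub]
    rw [inv_mul_le_iff₀ hk', mul_one, mul_nonneg_iff_of_pos_left (inv_pos.2 hk')]

theorem ehrhart_lipschitzPolytope {P : Type*} [PartialOrder P] [Finite P] (k : ℕ) :
    ehrhart (lipschitzPolytope P) k = (coverBounded P k).ncard := by
  have : Finite (WithBot P) := inferInstanceAs (Finite (Option P))
  symm
  refine Set.ncard_congr (fun g _ a => (g a : ℤ)) ?_ ?_ ?_
  · intro g hg
    rw [Set.mem_ofPred_eq, mem_smul_lipschitzPolytope_iff]
    have he : ∀ c, extendBot (fun a : P => (((g a : ℕ) : ℤ) : ℝ)) c = g c := by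
      intro c
      induction c using WithBot.recBotCoe with
      | bot => simp [extendBot, hg.1]
      | coe c => simp [extendBot]
    intro a b hab
    rw [he, he]
    have h1 : (g a : ℝ) ≤ g b := by exact_mod_cast (hg.2 a b hab).1
    have h2 : (g b : ℝ) ≤ g a + k := by exact_mod_cast (hg.2 a b hab).2
    constructor <;> linarith
  · intro g g' hg hg' h
    funext a
    induction a using WithBot.recBotCoe with
    | bot => rw [hg.1, hg'.1]
    | coe a => exact_mod_cast congrFun h a
  · intro x hx
    rw [Set.mem_ofPred_eq, mem_smul_lipschitzPolytope_iff] at hx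
    set X : WithBot P → ℤ := WithBot.recBotCoe 0 x with hX
    have he : ∀ c, extendBot (fun a : P => (x a : ℝ)) c = X c := by
      intro c
      induction c using WithBot.recBotCoe <;> simp [extendBot, hX]
    simp only [he] at hx
    have hx' : ∀ a b, a ⋖ b → X a ≤ X b ∧ X b ≤ X a + k := fun a b hab => by
      obtain ⟨h1, h2⟩ := hx a b hab
      constructor
      · exact_mod_cast sub_nonneg.1 h1
      · have : (X b : ℝ) ≤ X a + k := by linarith
        exact_mod_cast this
    have hpos : ∀ a, 0 ≤ X a := by
      intro a
      induction a using WellFoundedLT.induction with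
      | ind a ih =>
        rcases (bot_le (a := a)).eq_or_lt with rfl | hlt
        · exact le_rfl
        · obtain ⟨c, -, hc⟩ := exists_le_covBy_of_lt hlt
          exact (ih c hc.lt).trans (hx' c a hc).1
    refine ⟨fun a => (X a).toNat, ⟨rfl, fun a b hab => ?_⟩, ?_⟩
    · have := hx' a b hab
      have := hpos a
      have := hpos b
      dsimp only
      constructor <;> omega
    · funext a
      exact Int.toNat_of_nonneg (hpos a)

/-! ### Descents along saturated chains -/

theorem desWord_cons_cons (x y : ℕ) (w : List ℕ) :
    desWord (x :: y :: w) = desWord (y :: w) + if y < x then 1 else 0 := by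
  simp [desWord, List.countP_cons]

theorem desWord_concat (w : List ℕ) {x : ℕ} (hx : w.getLast? = some x) (y : ℕ) :
    desWord (w ++ [y]) = desWord w + if y < x then 1 else 0 := by
  induction w with
  | nil => simp at hx
  | cons a w ih =>
    cases w with
    | nil =>
      simp at hx
      subst hx
      simp [desWord, List.countP_cons]
    | cons b w =>
      have := ih (by simpa using hx)
      simp only [List.cons_append, desWord_cons_cons] at this ⊢
      omega

/-- The position of an element of `P̂` in the word `τ⁻¹(0) τ⁻¹(1) ⋯ τ⁻¹(n)`. -/
def position {P : Type*} {n : ℕ} (ω : P ≃ Fin n) (τ : Equiv.Perm (Fin n)) (a : WithBot P) :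
    Fin (n + 1) :=
  extendPerm τ (label ω a)

/-- The element of `P̂` at a given position of the word `τ⁻¹(0) τ⁻¹(1) ⋯ τ⁻¹(n)`. -/
def entry {P : Type*} {n : ℕ} (ω : P ≃ Fin n) (τ : Equiv.Perm (Fin n)) (j : Fin (n + 1)) :
    WithBot P :=
  element ω (extendPerm τ⁻¹ j)

section

variable {P : Type*} {n : ℕ} (ω : P ≃ Fin n) (τ : Equiv.Perm (Fin n))

theorem position_entry (j : Fin (n + 1)) : position ω τ (entry ω τ j) = j := by
  induction j using Fin.cases <;> simp [position, entry, element, extendPerm, label]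

theorem entry_position (a : WithBot P) : entry ω τ (position ω τ a) = a := by
  induction a using WithBot.recBotCoe <;> simp [position, entry, element, extendPerm, label]

theorem label_entry (j : Fin (n + 1)) : label ω (entry ω τ j) = extendPerm τ⁻¹ j := by
  induction j using Fin.cases <;> simp [entry, element, extendPerm, label]

theorem desInv_eq [PartialOrder P] (j : Fin (n + 1)) :
    desInv ω τ j = desAt ω τ (entry ω τ j) :=
  rfl

theorem entry_zero : entry ω τ 0 = ⊥ := rfl

theorem position_bot : position ω τ ⊥ = 0 := rfl

theorem label_injective : Function.Injective (label ω) := by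
  refine Function.LeftInverse.injective (g := element ω) fun a => ?_
  induction a using WithBot.recBotCoe <;> simp [label, element]

theorem label_strictMono [PartialOrder P] (hω : StrictMono ω) : StrictMono (label ω) := by
  intro a b h
  induction b using WithBot.recBotCoe with
  | bot => exact absurd h not_lt_bot
  | coe b =>
    induction a using WithBot.recBotCoe with
    | bot => exact Fin.succ_pos _
    | coe a => exact Fin.succ_lt_succ_iff.2 (hω (WithBot.coe_lt_coe.1 h))

variable [PartialOrder P]

/-- `q` counts the descents of `τ` along saturated chains starting at `0̂`. -/
def CountsDescents (q : WithBot P → ℕ) : Prop :=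
  q ⊥ = 0 ∧ ∀ a b, a ⋖ b → q b = q a + if position ω τ b < position ω τ a then 1 else 0

variable {ω τ}

/-- The cover relations telescope along a chain. The start is arbitrary so that the induction can
pass to the tail. -/
theorem eq_add_desWord {q : WithBot P → ℕ}
    (hq : ∀ a b, a ⋖ b → q b = q a + if position ω τ b < position ω τ a then 1 else 0)
    (l : List (WithBot P)) : ∀ {a b : WithBot P}, IsSaturatedChain a b l →
      q b = q a + desWord (subword ω τ l) := by
  induction l with
  | nil => intro a b h; simp [IsSaturatedChain] at h
  | cons x l ih =>
    intro a b h
    obtain ⟨h1, h2, h3⟩ := h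
    simp at h2
    subst h2
    cases l with
    | nil =>
      simp at h3
      subst h3
      simp [desWord, subword]
    | cons y l =>
      rw [List.isChain_cons_cons] at h1
      have hy := ih (a := y) (b := b) ⟨h1.2, by simp, by simpa using h3⟩
      have hxy := hq _ _ h1.1
      simp only [subword, List.map_cons, desWord_cons_cons] at hy ⊢
      simp only [position, Fin.lt_def] at hxy
      omega

theorem CountsDescents.isDescentCompatible {q : WithBot P → ℕ} (hq : CountsDescents ω τ q) :
    IsDescentCompatible ω τ := by
  intro a l l' hl hl'
  have h1 := eq_add_desWord hq.2 l hl
  have h2 := eq_add_desWord hq.2 l' hl'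
  omega

theorem CountsDescents.desAt_eq [Finite P] {q : WithBot P → ℕ} (hq : CountsDescents ω τ q) :
    desAt ω τ = q := by
  have : Finite (WithBot P) := inferInstanceAs (Finite (Option P))
  funext a
  obtain ⟨l, hl⟩ := exists_isSaturatedChain (bot_le (a := a))
  have : {m | ∃ l, IsSaturatedChain (⊥ : WithBot P) a l ∧ desWord (subword ω τ l) = m} = {q a} := by
    ext m
    constructor
    · rintro ⟨l', hl', rfl⟩
      have := eq_add_desWord hq.2 l' hl'
      rw [hq.1, zero_add] at this
      exact this.symm
    · rintro rfl
      have := eq_add_desWord hq.2 l hl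
      rw [hq.1, zero_add] at this
      exact ⟨l, hl, this.symm⟩
  rw [desAt, this, csInf_singleton]

theorem IsDescentCompatible.countsDescents [Finite P] (hτ : IsDescentCompatible ω τ) :
    CountsDescents ω τ (desAt ω τ) := by
  have : Finite (WithBot P) := inferInstanceAs (Finite (Option P))
  constructor
  · exact Nat.sInf_eq_zero.2 (Or.inl ⟨[⊥], isSaturatedChain_singleton _, rfl⟩)
  · intro a b hab
    -- Since `a` may be `⊥`, the chain is taken to attain the infimum; appending `b` to it gives a
    -- chain to `b`.
    obtain ⟨l, hl, hla⟩ : desAt ω τ a ∈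
        {m | ∃ l, IsSaturatedChain (⊥ : WithBot P) a l ∧ desWord (subword ω τ l) = m} := by
      obtain ⟨l, hl⟩ := exists_isSaturatedChain (bot_le (a := a))
      exact Nat.sInf_mem ⟨_, l, hl, rfl⟩
    induction b using WithBot.recBotCoe with
    | bot => exact absurd hab.lt not_lt_bot
    | coe b =>
      rw [LipschitzPoset.desAt_eq hτ (hl.concat hab), ← hla]
      rw [show subword ω τ (l ++ [(b : WithBot P)]) =
        subword ω τ l ++ [(position ω τ b : ℕ)] by simp [subword, position]]
      rw [desWord_concat (x := (position ω τ a : ℕ))]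
      · rfl
      · simp [subword, position, hl.2.2]

end

/-! ### Sorting by remainder -/

section

variable {P : Type*} {n : ℕ} (ω : P ≃ Fin n) (τ : Equiv.Perm (Fin n)) (q r : WithBot P → ℕ)

/-- Elements are compared by increasing `r`, then decreasing `q`, then increasing label. -/
def sortKey (a : WithBot P) : ℕ ×ₗ (ℕᵒᵈ ×ₗ Fin (n + 1)) :=
  toLex (r a, toLex (OrderDual.toDual (q a), label ω a))

variable {ω q r}

theorem sortKey_lt_iff {a b : WithBot P} : sortKey ω q r a < sortKey ω q r b ↔
    r a < r b ∨ r a = r b ∧ (q b < q a ∨ q a = q b ∧ label ω a < label ω b) := by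
  simp [sortKey, Prod.Lex.toLex_lt_toLex]

theorem sortKey_injective : Function.Injective (sortKey ω q r) := by
  intro a b h
  simp only [sortKey, EmbeddingLike.apply_eq_iff_eq, Prod.mk.injEq] at h
  exact label_injective ω h.2.2

/-- The steps at which the sorting order requires a strict increase of the remainder. -/
def strictSteps [PartialOrder P] (ω : P ≃ Fin n) (τ : Equiv.Perm (Fin n)) : Set (Fin n) :=
  {i : Fin n | desInv ω τ i.castSucc < desInv ω τ i.succ ∨
    (desInv ω τ i.castSucc = desInv ω τ i.succ ∧ i ∈ iDes τ)}

variable {τ}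

/-- It suffices to compare neighbours. A tie in `r` is allowed exactly when quotient and label
already order them correctly, which is the complement of the condition counted by `stat`. -/
theorem strictMono_sortKey_entry_iff [PartialOrder P] (hq : desAt ω τ = q) :
    StrictMono (sortKey ω q r ∘ entry ω τ) ↔
      ∀ i : Fin n, r (entry ω τ i.castSucc) ≤ r (entry ω τ i.succ) ∧
        (i ∈ strictSteps ω τ → r (entry ω τ i.castSucc) < r (entry ω τ i.succ)) := by
  rw [Fin.strictMono_iff_lt_succ]
  refine forall_congr' fun i => ?_
  have hne : label ω (entry ω τ i.castSucc) ≠ label ω (entry ω τ i.succ) := by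
    intro h
    have := congrArg (position ω τ) (label_injective ω h)
    rw [position_entry, position_entry] at this
    exact Fin.castSucc_lt_succ.ne this
  simp only [Function.comp_apply, sortKey_lt_iff, strictSteps, iDes, Set.mem_ofPred_eq, desInv_eq,
    ← label_entry ω τ, hq]
  rcases lt_or_gt_of_ne hne with h | h <;> simp only [h, h.not_gt, and_true, and_false] <;>
    grind

/-- By `h0`, only the label can break a tie in `r` with `⊥`, so `⊥` comes first and only `P` has to
be sorted. -/
theorem exists_strictMono_sortKey_entry (hr : r ⊥ = 0) (hq : q ⊥ = 0)
    (h0 : ∀ a, r a = 0 → q a = 0) :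
    ∃ τ : Equiv.Perm (Fin n), StrictMono (sortKey ω q r ∘ entry ω τ) := by
  let key : Fin n → ℕ ×ₗ (ℕᵒᵈ ×ₗ Fin (n + 1)) := fun i => sortKey ω q r (ω.symm i)
  have hkey : Function.Injective key := fun i j h =>
    ω.symm.injective (WithBot.coe_injective (sortKey_injective h))
  have hsort : StrictMono (key ∘ Tuple.sort key) :=
    (Tuple.monotone_sort key).strictMono_of_injective
      (hkey.comp (Tuple.sort key).injective)
  refine ⟨(Tuple.sort key)⁻¹, fun i j hij => ?_⟩
  induction j using Fin.cases with
  | zero => exact absurd hij (Fin.not_lt_zero i)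
  | succ j =>
    induction i using Fin.cases with
    | zero =>
      have hlt : label ω ⊥ < label ω (entry ω (Tuple.sort key)⁻¹ j.succ) := by
        rw [label_entry]
        exact Fin.succ_pos _
      rw [Function.comp_apply, Function.comp_apply, entry_zero, sortKey_lt_iff, hr, hq]
      have := h0 (entry ω (Tuple.sort key)⁻¹ j.succ)
      by_cases hz : r (entry ω (Tuple.sort key)⁻¹ j.succ) = 0
      · exact Or.inr ⟨hz.symm, Or.inr ⟨(this hz).symm, hlt⟩⟩
      · exact Or.inl (Nat.pos_of_ne_zero hz)
    | succ i =>
      have := hsort (Fin.succ_lt_succ_iff.1 hij)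
      simpa [entry, element, extendPerm, key] using this

theorem eq_of_strictMono_sortKey_entry {τ' : Equiv.Perm (Fin n)}
    (h : StrictMono (sortKey ω q r ∘ entry ω τ)) (h' : StrictMono (sortKey ω q r ∘ entry ω τ')) :
    τ = τ' := by
  have hs : ∀ τ : Equiv.Perm (Fin n), Function.Surjective (entry ω τ) := fun τ a =>
    ⟨_, entry_position ω τ a⟩
  have he := (StrictMono.range_inj h h').1 (by
    rw [Set.range_comp, Set.range_comp, (hs τ).range_eq, (hs τ').range_eq])
  have he' : entry ω τ = entry ω τ' := sortKey_injective.comp_left he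
  rw [← inv_inj]
  ext i
  have := congrArg (label ω) (congrFun he' i.succ)
  rw [label_entry, label_entry] at this
  simpa [extendPerm] using congrArg Fin.val this

theorem position_lt_iff (h : StrictMono (sortKey ω q r ∘ entry ω τ)) {a b : WithBot P} :
    position ω τ a < position ω τ b ↔ sortKey ω q r a < sortKey ω q r b := by
  rw [← h.lt_iff_lt, Function.comp_apply, Function.comp_apply, entry_position, entry_position]

end

/-! ### The decomposition of the lattice points -/

theorem exists_eq_mul_add (k g : ℕ) (hg : k = 0 → g = 0) :
    ∃ q r, g = k * q + r ∧ r ≤ k ∧ (r = 0 → q = 0) := by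
  rcases Nat.eq_zero_or_pos g with rfl | hpos
  · exact ⟨0, 0, by simp⟩
  · have hk : 0 < k := Nat.pos_of_ne_zero fun h => hpos.ne' (hg h)
    -- Dividing `g - 1` shifts the remainders from `0, …, k - 1` to `1, …, k`.
    refine ⟨(g - 1) / k, (g - 1) % k + 1, ?_, Nat.mod_lt _ hk, fun h => by omega⟩
    have := Nat.div_add_mod (g - 1) k
    omega

/-- If `q > q'`, then `r > 0` by `h0`, so the left side exceeds `k * (q' + 1)`, which bounds the
right side. -/
theorem le_of_mul_add_le {k q r q' r' : ℕ} (h : k * q + r ≤ k * q' + r')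
    (hr' : r' ≤ k) (h0 : r = 0 → q = 0) : q ≤ q' := by
  by_contra! hlt
  have h1 : k * (q' + 1) ≤ k * q := Nat.mul_le_mul_left k hlt
  rw [Nat.mul_succ] at h1
  omega

theorem eq_and_eq_of_mul_add_eq {k q r q' r' : ℕ} (h : k * q + r = k * q' + r')
    (hr : r ≤ k) (hr' : r' ≤ k) (h0 : r = 0 → q = 0) (h0' : r' = 0 → q' = 0) :
    q = q' ∧ r = r' := by
  obtain rfl : q = q' :=
    (le_of_mul_add_le h.le hr' h0).antisymm (le_of_mul_add_le h.ge hr h0')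
  exact ⟨rfl, by omega⟩

theorem eq_zero_of_mem_coverBounded_zero {P : Type*} [PartialOrder P] [Finite P]
    {g : WithBot P → ℕ} (hg : g ∈ coverBounded P 0) (a : WithBot P) : g a = 0 := by
  have : Finite (WithBot P) := inferInstanceAs (Finite (Option P))
  induction a using WellFoundedLT.induction with
  | ind a ih =>
    rcases (bot_le (a := a)).eq_or_lt with rfl | hlt
    · exact hg.1
    · obtain ⟨c, -, hc⟩ := exists_le_covBy_of_lt hlt
      have := hg.2 c a hc
      have := ih c hc.lt
      omega

section

variable {P : Type*} [PartialOrder P] {n : ℕ} {ω : P ≃ Fin n}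
  {τ : Equiv.Perm (Fin n)} {k : ℕ}

variable (ω τ k) in
/-- The lattice point with quotients `des_{P,τ}` and remainders given by a staircase. -/
def latticePoint (s : Fin (n + 1) → ℕ) (a : WithBot P) : ℕ :=
  k * desAt ω τ a + s (position ω τ a)

theorem latticePoint_mem [Finite P] (hτ : IsDescentCompatible ω τ) {s : Fin (n + 1) → ℕ}
    (hs : s ∈ staircases (strictSteps ω τ) k) : latticePoint ω τ k s ∈ coverBounded P k := by
  have hd := hτ.countsDescents
  refine ⟨?_, fun a b hab => ?_⟩
  · rw [latticePoint, hd.1, position_bot, hs.1, mul_zero]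
  · have ha := le_of_mem_staircases hs (position ω τ a)
    have hb := le_of_mem_staircases hs (position ω τ b)
    have hm := monotone_of_mem_staircases hs
    rw [latticePoint, latticePoint, hd.2 a b hab]
    -- At a descent the growth is `k` minus the drop in `s`; otherwise it is the rise in `s`. Both
    -- lie in `[0, k]` because `s` is monotone with values in `[0, k]`.
    split_ifs with h
    · have := hm h.le
      rw [Nat.mul_succ]
      omega
    · have := hm (not_lt.1 h)
      rw [add_zero]
      omega

theorem strictMono_sortKey_of_mem_staircases {s : Fin (n + 1) → ℕ}
    (hs : s ∈ staircases (strictSteps ω τ) k) :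
    StrictMono (sortKey ω (desAt ω τ) (s ∘ position ω τ) ∘ entry ω τ) := by
  rw [strictMono_sortKey_entry_iff rfl]
  simpa only [Function.comp_apply, position_entry] using hs.2.1

/-- This makes `desAt` and `s` a normalized quotient and remainder, so that the division is unique.
As `⊥` is first in the sorted word, an element tied with it at remainder 0 has quotient at most that
of `⊥`. -/
theorem desAt_eq_zero_of_mem_staircases [Finite P] (hτ : IsDescentCompatible ω τ)
    {s : Fin (n + 1) → ℕ} (hs : s ∈ staircases (strictSteps ω τ) k) {a : WithBot P} (ha : s (position ω τ a) = 0) :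
    desAt ω τ a = 0 := by
  have h := (strictMono_sortKey_of_mem_staircases hs).monotone (Fin.zero_le (position ω τ a))
  rw [Function.comp_apply, Function.comp_apply, entry_position, entry_zero] at h
  have h0 : desAt ω τ ⊥ = 0 := hτ.countsDescents.1
  rcases h.eq_or_lt with h | h
  · rw [← sortKey_injective h, h0]
  · rw [sortKey_lt_iff, h0, Function.comp_apply, Function.comp_apply, ha, position_bot, hs.1] at h
    omega

theorem latticePoint_injective [Finite P] {τ' : Equiv.Perm (Fin n)}
    (hτ : IsDescentCompatible ω τ)
    (hτ' : IsDescentCompatible ω τ') {s s' : Fin (n + 1) → ℕ}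
    (hs : s ∈ staircases (strictSteps ω τ) k) (hs' : s' ∈ staircases (strictSteps ω τ') k)
    (h : latticePoint ω τ k s = latticePoint ω τ' k s') : τ = τ' ∧ s = s' := by
  have heq : ∀ a, desAt ω τ a = desAt ω τ' a ∧ s (position ω τ a) = s' (position ω τ' a) :=
    fun a => eq_and_eq_of_mul_add_eq (congrFun h a) (le_of_mem_staircases hs _)
      (le_of_mem_staircases hs' _) (desAt_eq_zero_of_mem_staircases hτ hs)
      (desAt_eq_zero_of_mem_staircases hτ' hs')
  have hd : desAt ω τ = desAt ω τ' := funext fun a => (heq a).1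
  have hr : s ∘ position ω τ = s' ∘ position ω τ' := funext fun a => (heq a).2
  have hm' := strictMono_sortKey_of_mem_staircases hs'
  rw [← hd, ← hr] at hm'
  obtain rfl := eq_of_strictMono_sortKey_entry (strictMono_sortKey_of_mem_staircases hs) hm'
  refine ⟨rfl, funext fun j => ?_⟩
  simpa only [Function.comp_apply, position_entry] using congrFun hr (entry ω τ j)

/-- Along a cover relation the quotient increases exactly at the descents of the sorting
permutation. -/
theorem countsDescents_of_strictMono_sortKey (hω : StrictMono ω) {g q r : WithBot P → ℕ}
    (hg : g ∈ coverBounded P k) (hgqr : ∀ a, g a = k * q a + r a) (hr : ∀ a, r a ≤ k)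
    (h0 : ∀ a, r a = 0 → q a = 0) (h : StrictMono (sortKey ω q r ∘ entry ω τ)) :
    CountsDescents ω τ q := by
  refine ⟨h0 ⊥ ?_, fun a b hab => ?_⟩
  · have := hgqr ⊥
    rw [hg.1] at this
    omega
  · obtain ⟨h1, h2⟩ := hg.2 a b hab
    rw [hgqr, hgqr] at h1 h2
    have hl := label_strictMono ω hω hab.lt
    have hab1 : q a ≤ q b := le_of_mul_add_le h1 (hr b) (h0 a)
    have hab2 : q b ≤ q a + 1 :=
      le_of_mul_add_le (k := k) (r := r b) (r' := r a) (by rw [Nat.mul_succ]; omega) (hr a)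
        (h0 b)
    rw [if_congr ((position_lt_iff h).trans sortKey_lt_iff) rfl rfl]
    -- For equal quotients `r a ≤ r b`, and natural labeling breaks a tie in favour of `a`. If the
    -- quotient grows, the upper bound `k` forces `r b ≤ r a`, and a tie puts the larger quotient,
    -- that of `b`, first.
    rcases hab1.eq_or_lt with he | hlt
    · rw [he] at h1
      rw [if_neg, he, add_zero]
      have := hl.not_gt
      omega
    · have he : q b = q a + 1 := by omega
      rw [he, Nat.mul_succ] at h2
      rw [if_pos, he]
      omega

theorem exists_latticePoint_eq [Finite P] (hω : StrictMono ω) {g : WithBot P → ℕ}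
    (hg : g ∈ coverBounded P k) : ∃ τ : Equiv.Perm (Fin n), IsDescentCompatible ω τ ∧
      ∃ s ∈ staircases (strictSteps ω τ) k, latticePoint ω τ k s = g := by
  choose q r hgqr hr h0 using fun a => exists_eq_mul_add k (g a) (by
    rintro rfl
    exact eq_zero_of_mem_coverBounded_zero hg a)
  have hr0 : r ⊥ = 0 := by
    have := hgqr ⊥
    rw [hg.1] at this
    omega
  obtain ⟨τ, hτ⟩ := exists_strictMono_sortKey_entry (ω := ω) hr0 (h0 ⊥ hr0) h0
  have hq := countsDescents_of_strictMono_sortKey hω hg hgqr hr h0 hτ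
  refine ⟨τ, hq.isDescentCompatible, r ∘ entry ω τ,
    ⟨hr0, (strictMono_sortKey_entry_iff hq.desAt_eq).1 hτ, hr _⟩, funext fun a => ?_⟩
  rw [latticePoint, hq.desAt_eq, Function.comp_apply, entry_position, hgqr]

variable (ω k) in
open Classical in
theorem ncard_coverBounded [Finite P] (hω : StrictMono ω) :
    (coverBounded P k).ncard =
      ∑ τ : Equiv.Perm (Fin n) with IsDescentCompatible ω τ,
        (staircases (strictSteps ω τ) k).ncard := by
  have himage : coverBounded P k = ⋃ τ ∈ {τ : Equiv.Perm (Fin n) | IsDescentCompatible ω τ},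
      latticePoint ω τ k '' staircases (strictSteps ω τ) k := by
    ext g
    simp only [Set.mem_iUnion, Set.mem_image, exists_prop, Set.mem_ofPred_eq]
    constructor
    · exact exists_latticePoint_eq hω
    · rintro ⟨τ, hτ, s, hs, rfl⟩
      exact latticePoint_mem hτ hs
  rw [himage, Set.Finite.ncard_biUnion (Set.toFinite _)
    (fun τ _ => (finite_staircases _ k).image _), finsum_mem_eq_finite_toFinset_sum _
      (Set.toFinite _)]
  · refine Finset.sum_congr (by ext; simp) fun τ hτ => ?_
    have hτ' : IsDescentCompatible ω τ := by simpa using hτ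
    exact Set.InjOn.ncard_image fun s hs s' hs' h =>
      (latticePoint_injective hτ' hτ' hs hs' h).2
  · intro τ hτ τ' hτ' hne
    refine Set.disjoint_left.2 ?_
    rintro _ ⟨s, hs, rfl⟩ ⟨s', hs', h⟩
    exact hne (latticePoint_injective hτ hτ' hs hs' h.symm).1

end

/-! ### Summing the generating functions over descent-compatible permutations -/

theorem hStar_lipschitzPolytope {P : Type*} [PartialOrder P] {n : ℕ} (ω : P ≃ Fin n)
    (hω : StrictMono ω) : hStar (lipschitzPolytope P) = (statPolynomial ω : PowerSeries ℤ) := by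
  classical
  have : Finite P := Finite.of_equiv _ ω.symm
  have hcard : Nat.card P = n := by simp [Nat.card_congr ω]
  have hmk : PowerSeries.mk (fun k => (ehrhart (lipschitzPolytope P) k : ℤ)) =
      ∑ τ : Equiv.Perm (Fin n) with IsDescentCompatible ω τ,
        PowerSeries.mk (fun k => ((staircases (strictSteps ω τ) k).ncard : ℤ)) := by
    ext k
    rw [map_sum, PowerSeries.coeff_mk, ehrhart_lipschitzPolytope, ncard_coverBounded ω k hω]
    simp
  rw [hStar, hcard, hmk, Finset.mul_sum, statPolynomial,
    ← Polynomial.coeToPowerSeries.ringHom_apply, map_sum]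
  refine Finset.sum_congr rfl fun τ _ => ?_
  rw [one_sub_X_pow_mul_mk_ncard_staircases]
  simp [stat, strictSteps]

end LipschitzPoset

end

theorem theorem3p2 {P : Type*} [PartialOrder P] {n : ℕ} (ω : P ≃ Fin n) (hω : StrictMono ω) :
    LipschitzPoset.hStar (LipschitzPoset.lipschitzPolytope P) =
      (LipschitzPoset.statPolynomial ω : PowerSeries ℤ) :=
  LipschitzPoset.hStar_lipschitzPolytope ω hω
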